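/- Let $F$ be an arbitrary field and let $r,q\in F$ be non-zero elements with $q-q^{-1}\neq 0$ such that $a:=\dfrac{r-r^{-1}}{q-q^{-1}}$ is non-zero. For $n\ge 2$ the $q$-Brauer algebra $Br_n(r^2,q^2)$ over $F$ is the unital associative $F$-algebra with generators $g_1,\dots,g_{n-1},e$ and the following defining relations (each imposed when all the $g_i$ occurring in it exist): (H) $g_i^2=(q^2-1)g_i+q^2$ for $1\le i<n$; $g_ig_{i+1}g_i=g_{i+1}g_ig_{i+1}$ for $1\le i<n-1$; $g_ig_j=g_jg_i$ for $|i-j|\ge 2$; ($E_1$) $e^2=a\,e$; ($E_2$) $eg_i=g_ie$ for $i>2$; $eg_1=g_1e=q^2e$; $eg_2e=rq\,e$; $eg_2^{-1}e=(rq)^{-1}e$; ($E_3$) $g_2g_3g_1^{-1}g_2^{-1}e_{(2)}=e_{(2)}g_2g_3g_1^{-1}g_2^{-1}$, where $e_{(2)}=e(g_2g_3g_1^{-1}g_2^{-1})e$. Let $e(q^2)$ be the least positive integer $m$ with $1+q^2+q^4+\dots+q^{2(m-1)}=0$ in $F$, and $e(q^2)=\infty$ if there is no such $m$. Then: 1.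 $Br_2(r^2,q^2)$ is semisimple if and only if $e(q^2)>2$. 2. $Br_3(r^2,q^2)$ is semisimple if and only if $e(q^2)>3$ and $$\frac{q^5(r^2-q^2)^2(q^4r^2-1)}{r^3(q^2-1)^3}\neq 0.$$ -/

import Mathlib

/-- `quantumChar x` is `e(x)`: the least positive integer `m` with
`[m]_x = 1 + x + ⋯ + x ^ (m - 1) = 0`, and `∞` if there is none. -/
noncomputable def quantumChar {F : Type*} [Field F] (x : F) : ℕ∞ :=
  ⨅ (m : ℕ) (_ : 0 < m ∧ ∑ i ∈ Finset.range m, x ^ i = 0), (m : ℕ∞)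

namespace QBrauer

/-- The generators `g₁, …, g_{n-1}` and `e` of the `q`-Brauer algebra on `n` strands (`n ≥ 2`). -/
inductive Gen (n : ℕ) : Type
  | g (i : ℕ) (hi : 1 ≤ i ∧ i < n) : Gen n
  | e : Gen n

section Presentation

variable {F : Type*} [Field F] {n : ℕ}

/-- The free generator `g_i`. -/
def g (F : Type*) [Field F] {n : ℕ} (i : ℕ) (hi : 1 ≤ i ∧ i < n) : FreeAlgebra F (Gen n) :=
  FreeAlgebra.ι F (Gen.g i hi)

/-- The free generator `e`. -/
def e (F : Type*) [Field F] (n : ℕ) : FreeAlgebra F (Gen n) :=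
  FreeAlgebra.ι F Gen.e

/-- A word representing `g_i⁻¹`, namely `q⁻² (g_i - (q² - 1))`. That it is inverse to `g_i` in
the `q`-Brauer algebra (for `q ≠ 0`) is proved in `mk_g_mul_mk_gInv` and `mk_gInv_mul_mk_g`. -/
noncomputable def gInv (q : F) (i : ℕ) (hi : 1 ≤ i ∧ i < n) : FreeAlgebra F (Gen n) :=
  (q ^ 2)⁻¹ • (g F i hi - algebraMap F _ (q ^ 2 - 1))

/-- The element `g₂ g₃ g₁⁻¹ g₂⁻¹` (for `n ≥ 4`). -/
noncomputable def c (q : F) (hn : 3 < n) : FreeAlgebra F (Gen n) :=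
  g F 2 ⟨by omega, by omega⟩ * g F 3 ⟨by omega, by omega⟩ *
    gInv q 1 ⟨by omega, by omega⟩ * gInv q 2 ⟨by omega, by omega⟩

/-- The element `e₍₂₎ = e (g₂ g₃ g₁⁻¹ g₂⁻¹) e` (for `n ≥ 4`). -/
noncomputable def e₂ (q : F) (hn : 3 < n) : FreeAlgebra F (Gen n) :=
  e F n * c q hn * e F n

/-- The defining relations of the `q`-Brauer algebra `Br_n(r², q²)`. A relation is present exactly
when all the `g_i` that occur in it are among `g₁, …, g_{n-1}`. -/
inductive Rel (n : ℕ) (r q : F) : FreeAlgebra F (Gen n) → FreeAlgebra F (Gen n) → Prop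
  -- the relations of the Hecke algebra `H_n(q²)`
  | quadratic (i : ℕ) (hi : 1 ≤ i ∧ i < n) :
      Rel n r q (g F i hi ^ 2) ((q ^ 2 - 1) • g F i hi + algebraMap F _ (q ^ 2))
  | braid (i : ℕ) (hi : 1 ≤ i ∧ i < n) (hi' : 1 ≤ i + 1 ∧ i + 1 < n) :
      Rel n r q (g F i hi * g F (i + 1) hi' * g F i hi)
        (g F (i + 1) hi' * g F i hi * g F (i + 1) hi')
  | comm (i j : ℕ) (hi : 1 ≤ i ∧ i < n) (hj : 1 ≤ j ∧ j < n) (hij : i + 2 ≤ j) :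
      Rel n r q (g F i hi * g F j hj) (g F j hj * g F i hi)
  -- the relation for `e²`
  | e_sq : Rel n r q (e F n ^ 2) (((r - r⁻¹) / (q - q⁻¹)) • e F n)
  -- the relations between `e` and the `g_i`
  | e_comm (i : ℕ) (hi : 1 ≤ i ∧ i < n) (h2 : 2 < i) :
      Rel n r q (e F n * g F i hi) (g F i hi * e F n)
  | e_g₁ (h : 1 ≤ 1 ∧ 1 < n) : Rel n r q (e F n * g F 1 h) (q ^ 2 • e F n)
  | g₁_e (h : 1 ≤ 1 ∧ 1 < n) : Rel n r q (g F 1 h * e F n) (q ^ 2 • e F n)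
  | e_g₂_e (h : 1 ≤ 2 ∧ 2 < n) : Rel n r q (e F n * g F 2 h * e F n) ((r * q) • e F n)
  | e_g₂Inv_e (h : 1 ≤ 2 ∧ 2 < n) :
      Rel n r q (e F n * gInv q 2 h * e F n) ((r * q)⁻¹ • e F n)
  -- the relation for `e₍₂₎`
  | c_e₂ (hn : 3 < n) : Rel n r q (c q hn * e₂ q hn) (e₂ q hn * c q hn)

end Presentation

end QBrauer

/-- The `q`-Brauer algebra `Br_n(r², q²)` over the field `F` (for `n ≥ 2`), presented by
generators and relations. It is a unital associative `F`-algebra. -/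
abbrev QBrauerAlgebra (F : Type*) [Field F] (n : ℕ) (r q : F) : Type _ :=
  RingQuot (QBrauer.Rel n r q)

namespace QBrauer

theorem mk_g_mul_mk_gInv {F : Type*} [Field F] {n : ℕ} (r : F) {q : F} (hq : q ≠ 0) (i : ℕ)
    (hi : 1 ≤ i ∧ i < n) :
    RingQuot.mkAlgHom F (Rel n r q) (g F i hi) * RingQuot.mkAlgHom F (Rel n r q) (gInv q i hi)
      = 1 := by
  have h := RingQuot.mkAlgHom_rel F (Rel.quadratic (r := r) (q := q) i hi)
  rw [map_pow, map_add, map_smul, AlgHom.commutes] at h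
  rw [gInv, map_smul, map_sub, AlgHom.commutes, mul_smul_comm, mul_sub, ← pow_two, h,
    ← Algebra.commutes, ← Algebra.smul_def, add_sub_cancel_left, Algebra.algebraMap_eq_smul_one,
    smul_smul, inv_mul_cancel₀ (pow_ne_zero 2 hq), one_smul]

theorem mk_gInv_mul_mk_g {F : Type*} [Field F] {n : ℕ} (r : F) {q : F} (hq : q ≠ 0) (i : ℕ)
    (hi : 1 ≤ i ∧ i < n) :
    RingQuot.mkAlgHom F (Rel n r q) (gInv q i hi) * RingQuot.mkAlgHom F (Rel n r q) (g F i hi)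
      = 1 := by
  rw [← mk_g_mul_mk_gInv r hq i hi]
  simp only [gInv, map_smul, map_sub, AlgHom.commutes, mul_smul_comm, smul_mul_assoc, mul_sub,
    sub_mul, Algebra.commutes]

end QBrauer

/-! ### Quantum characteristic -/

/-! Let `A` be the algebra on three strands and `t = q²`. The left ideal `A e` is spanned by the
`h_j e` with `h = (1, g₂, g₁g₂)`, the right ideal `e A` by the `e h'_i` with `h' = (1, g₂, g₂g₁)`,
and `e h'_i h_j e = G_ij e`. The determinant of `G` is the displayed fraction (`det_gram`).

If `det G ≠ 0`, then `A e` is simple or zero, and the inverse of `G` yields `u` in `A e A` with `e y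
u = e y` for all `y`. Multiplying by `1 - u` reduces the rest to the Hecke algebra, where `e` acts
as `0`. Its symmetrizer, a two-dimensional constituent and its antisymmetrizer all land in the
socle, which then contains `1` (`IsThreeStrand.isSemisimpleRing`). Since "simple or zero" suffices
throughout, no basis of `A` is needed.

Conversely, a semisimple ring is von Neumann regular, so a nonzero `x` with `x A x = 0`, possibly
seen only in an image of `A`, refutes semisimplicity. There is one such `x` for each of `1 + t = 0`,
`1 + t + t² = 0` and `det G = 0`. Two strands need only one-dimensional modules. -/

theorem lt_quantumChar_iff {F : Type*} [Field F] (x : F) (k : ℕ) :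
    (k : ℕ∞) < quantumChar x ↔ ∀ m, 0 < m → m ≤ k → ∑ i ∈ Finset.range m, x ^ i ≠ 0 := by
  rw [← not_le, quantumChar]
  constructor
  · intro h m hm hmk h0
    exact h ((iInf₂_le m ⟨hm, h0⟩).trans (by exact_mod_cast hmk))
  · intro h hle
    -- Every admissible `m` is at least `k + 1`, hence so is the infimum, also when it is `∞` over
    -- the empty family.
    have : ((k + 1 : ℕ) : ℕ∞) ≤ k := by
      refine le_trans (le_iInf₂ fun m hm ↦ ?_) hle
      by_contra hlt
      exact h m hm.1 (by have := not_le.mp hlt; norm_cast at this; omega) hm.2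
    norm_cast at this
    omega

theorem two_lt_quantumChar_iff {F : Type*} [Field F] (x : F) :
    2 < quantumChar x ↔ 1 + x ≠ 0 := by
  rw [show (2 : ℕ∞) = ((2 : ℕ) : ℕ∞) from rfl, lt_quantumChar_iff]
  constructor
  · intro h
    simpa [Finset.sum_range_succ] using h 2 (by norm_num) le_rfl
  · intro h m h0 h2
    interval_cases m <;> simp [Finset.sum_range_succ, h]

theorem three_lt_quantumChar_iff {F : Type*} [Field F] (x : F) :
    3 < quantumChar x ↔ 1 + x ≠ 0 ∧ 1 + x + x ^ 2 ≠ 0 := by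
  rw [show (3 : ℕ∞) = ((3 : ℕ) : ℕ∞) from rfl, lt_quantumChar_iff]
  constructor
  · intro h
    exact ⟨by simpa [Finset.sum_range_succ] using h 2 (by norm_num) (by norm_num),
      by simpa [Finset.sum_range_succ] using h 3 (by norm_num) le_rfl⟩
  · intro h m h0 h2
    interval_cases m <;> simp [Finset.sum_range_succ, h]

/-! ### Criteria for semisimplicity -/

/-- `x` generates a left ideal that is simple or zero. -/
def GeneratesMinimal {R : Type*} [Ring R] (x : R) : Prop :=
  ∀ y, y * x ≠ 0 → ∃ z, z * (y * x) = x

namespace GeneratesMinimal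

variable {R : Type*} [Ring R]

/-- Right multiplication is a map of left modules, so `R x r` is a quotient of `R x`. This makes the
socle a two-sided ideal. -/
theorem mul_right {x : R} (hx : GeneratesMinimal x) (r : R) : GeneratesMinimal (x * r) := by
  intro y hy
  obtain ⟨z, hz⟩ := hx y fun h ↦ hy (by rw [← mul_assoc, h, zero_mul])
  exact ⟨z, by rw [← mul_assoc y, ← mul_assoc, hz]⟩

theorem isSimpleModule_span {x : R} (hx : GeneratesMinimal x) (h0 : x ≠ 0) :
    IsSimpleModule R (Submodule.span R {x}) := by
  rw [isSimpleModule_iff_isAtom]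
  refine ⟨by simpa using h0, fun J hJ ↦ ?_⟩
  by_contra hne
  obtain ⟨w, hw, hw0⟩ := (Submodule.ne_bot_iff _).mp hne
  obtain ⟨y, rfl⟩ := Submodule.mem_span_singleton.mp (hJ.le hw)
  obtain ⟨z, hz⟩ := hx y hw0
  refine hJ.not_ge ((Submodule.span_singleton_le_iff_mem _ _).mpr ?_)
  rw [← hz]
  exact J.smul_mem z hw

variable (R) in
/-- The sum of all left ideals `R x` that are simple or zero; this is the socle. -/
def socle : Submodule R R := Submodule.span R {x | GeneratesMinimal x}

theorem mem_socle {x : R} (hx : GeneratesMinimal x) : x ∈ socle R := Submodule.subset_span hx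

theorem mul_mem_socle_left {x : R} (y : R) (hx : x ∈ socle R) : y * x ∈ socle R :=
  (socle R).smul_mem y hx

theorem mul_mem_socle_right {x : R} (hx : x ∈ socle R) (y : R) : x * y ∈ socle R := by
  induction hx using Submodule.span_induction with
  | mem x h => exact mem_socle (h.mul_right y)
  | zero => simp
  | add a b _ _ ha hb => rw [add_mul]; exact add_mem ha hb
  | smul c a _ ha => rw [smul_eq_mul, mul_assoc]; exact mul_mem_socle_left c ha

theorem smul_mem_socle {F : Type*} [Field F] [Algebra F R] {x : R} (c : F) (hx : x ∈ socle R) :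
    c • x ∈ socle R := by
  rw [Algebra.smul_def]
  exact mul_mem_socle_left _ hx

theorem isSemisimpleRing (h : (1 : R) ∈ socle R) : IsSemisimpleRing R := by
  refine IsSemisimpleModule.of_sSup_simples_eq_top ?_
  rw [eq_top_iff]
  have hle : socle R ≤ sSup {m : Submodule R R | IsSimpleModule R m} := by
    refine Submodule.span_le.mpr fun x hx ↦ ?_
    by_cases h0 : x = 0
    · rw [h0]; exact zero_mem _
    · exact le_sSup (a := Submodule.span R {x}) (isSimpleModule_span hx h0)
        (Submodule.mem_span_singleton_self x)
  intro x _
  simpa using hle (mul_mem_socle_left x h)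

end GeneratesMinimal

/-- Split `1 = y x + z` along `R x ⊕ C`. Then `x z = x - x y x` lies in both summands, so it
vanishes. -/
theorem IsSemisimpleRing.exists_mul_mul_eq {R : Type*} [Ring R] [IsSemisimpleRing R] (x : R) :
    ∃ y, x * y * x = x := by
  obtain ⟨C, hC⟩ := exists_isCompl (Submodule.span R {x})
  have h1 : (1 : R) ∈ Submodule.span R {x} ⊔ C := by rw [hC.sup_eq_top]; trivial
  obtain ⟨u, hu, z, hz, huz⟩ := Submodule.mem_sup.mp h1
  obtain ⟨y, rfl⟩ := Submodule.mem_span_singleton.mp hu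
  refine ⟨y, ?_⟩
  have hx : x * z = x - x * y * x := by
    rw [eq_sub_iff_add_eq', mul_assoc, ← smul_eq_mul y x, ← mul_add, huz, mul_one]
  have h0 : x * z ∈ Submodule.span R {x} ⊓ C := by
    refine ⟨?_, C.smul_mem x hz⟩
    rw [hx]
    refine sub_mem (Submodule.mem_span_singleton_self x) ?_
    exact Submodule.mem_span_singleton.mpr ⟨x * y, rfl⟩
  rw [hC.inf_eq_bot, Submodule.mem_bot, hx, sub_eq_zero] at h0
  exact h0.symm

theorem not_isSemisimpleRing_of_map {R S : Type*} [Ring R] [Ring S] (f : R →+* S) (x : R)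
    (hx : f x ≠ 0) (h : ∀ y, f (x * y * x) = 0) : ¬ IsSemisimpleRing R := by
  intro _
  obtain ⟨y, hy⟩ := IsSemisimpleRing.exists_mul_mul_eq x
  exact hx (by rw [← hy]; exact h y)

/-! ### Submodules stable under generators -/

section Generators

variable {F A : Type*} [Field F] [Ring A] [Algebra F A] {S : Set A}

theorem mul_mem_of_adjoin_eq_top (hS : Algebra.adjoin F S = ⊤) {V : Set A}
    (h : ∀ s ∈ S, ∀ v ∈ V, s * v ∈ Submodule.span F V) (y : A) {w : A}
    (hw : w ∈ Submodule.span F V) : y * w ∈ Submodule.span F V := by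
  have hy : y ∈ Algebra.adjoin F S := by rw [hS]; trivial
  induction hy using Algebra.adjoin_induction generalizing w with
  | mem s hs =>
    induction hw using Submodule.span_induction with
    | mem v hv => exact h s hs v hv
    | zero => simp
    | add a b _ _ ha hb => rw [mul_add]; exact add_mem ha hb
    | smul c a _ ha => rw [mul_smul_comm]; exact Submodule.smul_mem _ c ha
  | algebraMap c => rw [← Algebra.smul_def]; exact Submodule.smul_mem _ c hw
  | add a b _ _ ha hb => rw [add_mul]; exact add_mem (ha hw) (hb hw)
  | mul a b _ _ ha hb => rw [mul_assoc]; exact ha (hb hw)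

theorem mem_mul_of_adjoin_eq_top (hS : Algebra.adjoin F S = ⊤) {V : Set A}
    (h : ∀ s ∈ S, ∀ v ∈ V, v * s ∈ Submodule.span F V) (y : A) {w : A}
    (hw : w ∈ Submodule.span F V) : w * y ∈ Submodule.span F V := by
  have hy : y ∈ Algebra.adjoin F S := by rw [hS]; trivial
  induction hy using Algebra.adjoin_induction generalizing w with
  | mem s hs =>
    induction hw using Submodule.span_induction with
    | mem v hv => exact h s hs v hv
    | zero => simp
    | add a b _ _ ha hb => rw [add_mul]; exact add_mem ha hb
    | smul c a _ ha => rw [smul_mul_assoc]; exact Submodule.smul_mem _ c ha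
  | algebraMap c => rw [← Algebra.commutes, ← Algebra.smul_def]; exact Submodule.smul_mem _ c hw
  | add a b _ _ ha hb => rw [mul_add]; exact add_mem (ha hw) (hb hw)
  | mul a b _ _ ha hb => rw [← mul_assoc]; exact hb (ha hw)

/-- A common eigenvector of a set of generators generates a left ideal that is simple or zero. -/
theorem GeneratesMinimal.of_eigenvector (hS : Algebra.adjoin F S = ⊤) {x : A}
    (h : ∀ s ∈ S, ∃ c : F, s * x = c • x) : GeneratesMinimal x := by
  intro y hy
  have hyx : y * x ∈ Submodule.span F {x} :=
    mul_mem_of_adjoin_eq_top hS (by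
      rintro s hs _ rfl
      obtain ⟨c, hc⟩ := h s hs
      exact Submodule.mem_span_singleton.mpr ⟨c, hc.symm⟩) y (Submodule.mem_span_singleton_self x)
  obtain ⟨c, hc⟩ := Submodule.mem_span_singleton.mp hyx
  have h0 : c ≠ 0 := by rintro rfl; exact hy (by rw [← hc, zero_smul])
  exact ⟨algebraMap F A c⁻¹, by rw [← hc, ← Algebra.smul_def, smul_smul, inv_mul_cancel₀ h0, one_smul]⟩

end Generators

/-! ### The algebra on three strands -/

/-- The elements `g₁, g₂, e` generate `A` and satisfy the relations of `Br₃` with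
`q² = t`, `e² = a e` and `e g₂ e = x e`. -/
structure IsThreeStrand {F A : Type*} [Field F] [Ring A] [Algebra F A] (t a x : F)
    (g₁ g₂ e : A) : Prop where
  adjoin_eq_top : Algebra.adjoin F {g₁, g₂, e} = ⊤
  g₁_sq : g₁ * g₁ = (t - 1) • g₁ + t • 1
  g₂_sq : g₂ * g₂ = (t - 1) • g₂ + t • 1
  braid : g₁ * g₂ * g₁ = g₂ * g₁ * g₂
  e_sq : e * e = a • e
  e_g₁ : e * g₁ = t • e
  g₁_e : g₁ * e = t • e
  e_g₂_e : e * g₂ * e = x • e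

namespace IsThreeStrand

open GeneratesMinimal

/-- The matrix with entries given by `e h'ᵢ hⱼ e = Gᵢⱼ e`, where `h = (1, g₂, g₁ g₂)` and
`h' = (1, g₂, g₂ g₁)`. -/
def gram {F : Type*} [Field F] (t a x : F) : Matrix (Fin 3) (Fin 3) F :=
  !![a, x, t * x;
     x, (t - 1) * x + t * a, t ^ 2 * x;
     t * x, t ^ 2 * x, (t - 1) * t ^ 2 * x + t * ((t - 1) * x + t * a)]

variable {F A : Type*} [Field F] [Ring A] [Algebra F A] {t a x : F} {g₁ g₂ e : A}

/-- Rewriting rules for right-associated words. -/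
theorem rules (H : IsThreeStrand t a x g₁ g₂ e) :
    g₁ * g₁ = (t - 1) • g₁ + t • 1 ∧ g₂ * g₂ = (t - 1) • g₂ + t • 1 ∧
    (∀ z, g₁ * (g₁ * z) = (t - 1) • (g₁ * z) + t • z) ∧
    (∀ z, g₂ * (g₂ * z) = (t - 1) • (g₂ * z) + t • z) ∧
    g₂ * (g₁ * g₂) = g₁ * (g₂ * g₁) ∧
    (∀ z, g₂ * (g₁ * (g₂ * z)) = g₁ * (g₂ * (g₁ * z))) ∧
    e * e = a • e ∧ (∀ z, e * (e * z) = a • (e * z)) ∧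
    e * g₁ = t • e ∧ (∀ z, e * (g₁ * z) = t • (e * z)) ∧
    g₁ * e = t • e ∧ (∀ z, g₁ * (e * z) = t • (e * z)) ∧
    e * (g₂ * e) = x • e ∧ (∀ z, e * (g₂ * (e * z)) = x • (e * z)) := by
  refine ⟨H.g₁_sq, H.g₂_sq, fun z ↦ ?_, fun z ↦ ?_, ?_, fun z ↦ ?_, H.e_sq, fun z ↦ ?_, H.e_g₁,
    fun z ↦ ?_, H.g₁_e, fun z ↦ ?_, ?_, fun z ↦ ?_⟩
  · rw [← mul_assoc, H.g₁_sq, add_mul, smul_mul_assoc, smul_mul_assoc, one_mul]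
  · rw [← mul_assoc, H.g₂_sq, add_mul, smul_mul_assoc, smul_mul_assoc, one_mul]
  · rw [← mul_assoc, ← mul_assoc, H.braid]
  · simp only [← mul_assoc, H.braid]
  · rw [← mul_assoc, H.e_sq, smul_mul_assoc]
  · rw [← mul_assoc, H.e_g₁, smul_mul_assoc]
  · rw [← mul_assoc, H.g₁_e, smul_mul_assoc]
  · rw [← mul_assoc, H.e_g₂_e]
  · rw [← mul_assoc, ← mul_assoc, H.e_g₂_e, smul_mul_assoc]

/-! ### The one-sided ideals generated by `e` and their Gram matrix. -/

variable (g₁ g₂) in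
/-- Left multipliers: `A e` is spanned by `leftWord i * e`. -/
def leftWord : Fin 3 → A := ![1, g₂, g₁ * g₂]

variable (g₁ g₂) in
/-- Right multipliers: `e A` is spanned by `e * rightWord i`. -/
def rightWord : Fin 3 → A := ![1, g₂, g₂ * g₁]

theorem e_rightWord_leftWord_e (H : IsThreeStrand t a x g₁ g₂ e) (i j : Fin 3) :
    e * rightWord g₁ g₂ i * (leftWord g₁ g₂ j * e) = gram t a x i j • e := by
  fin_cases i <;> fin_cases j <;>
    simp only [rightWord, leftWord, gram, Fin.zero_eta, Fin.mk_one, Fin.reduceFinMk,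
      Matrix.cons_val, Matrix.of_apply, one_mul, mul_one, mul_assoc, H.rules, mul_add,
      mul_smul_comm] <;> module

theorem mul_e_mem (H : IsThreeStrand t a x g₁ g₂ e) (y : A) :
    ∃ c : Fin 3 → F, y * e = ∑ j, c j • (leftWord g₁ g₂ j * e) := by
  suffices h : y * e ∈ Submodule.span F (Set.range fun j ↦ leftWord g₁ g₂ j * e) by
    obtain ⟨c, hc⟩ := (Submodule.mem_span_range_iff_exists_fun F).mp h
    exact ⟨c, hc.symm⟩
  refine mul_mem_of_adjoin_eq_top H.adjoin_eq_top ?_ y (Submodule.subset_span ⟨0, by simp [leftWord]⟩)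
  rintro s hs _ ⟨j, rfl⟩
  rw [Submodule.mem_span_range_iff_exists_fun]
  simp only [Set.mem_insert_iff, Set.mem_singleton_iff] at hs
  obtain rfl | rfl | rfl := hs
  -- Row `j` holds the coordinates of the generator times `h_j e`.
  · refine ⟨![![t, 0, 0], ![0, 0, 1], ![0, t, t - 1]] j, ?_⟩
    fin_cases j <;>
      simp only [Fin.sum_univ_three, leftWord, Fin.zero_eta, Fin.mk_one, Fin.reduceFinMk,
        Matrix.cons_val, one_mul, mul_assoc, H.rules] <;> module
  · refine ⟨![![0, 1, 0], ![t, t - 1, 0], ![0, 0, t]] j, ?_⟩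
    fin_cases j <;>
      simp only [Fin.sum_univ_three, leftWord, Fin.zero_eta, Fin.mk_one, Fin.reduceFinMk,
        Matrix.cons_val, one_mul, mul_assoc, H.rules, mul_smul_comm] <;> module
  · refine ⟨![gram t a x 0 j, 0, 0], ?_⟩
    have := H.e_rightWord_leftWord_e 0 j
    simp only [rightWord, Matrix.cons_val, mul_one] at this
    simp only [Fin.sum_univ_three, this]
    simp [leftWord]

theorem e_mul_mem (H : IsThreeStrand t a x g₁ g₂ e) (y : A) :
    ∃ c : Fin 3 → F, e * y = ∑ j, c j • (e * rightWord g₁ g₂ j) := by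
  suffices h : e * y ∈ Submodule.span F (Set.range fun j ↦ e * rightWord g₁ g₂ j) by
    obtain ⟨c, hc⟩ := (Submodule.mem_span_range_iff_exists_fun F).mp h
    exact ⟨c, hc.symm⟩
  refine mem_mul_of_adjoin_eq_top H.adjoin_eq_top ?_ y
    (Submodule.subset_span ⟨0, by simp [rightWord]⟩)
  rintro s hs _ ⟨j, rfl⟩
  rw [Submodule.mem_span_range_iff_exists_fun]
  simp only [Set.mem_insert_iff, Set.mem_singleton_iff] at hs
  obtain rfl | rfl | rfl := hs
  · refine ⟨![![t, 0, 0], ![0, 0, 1], ![0, t, t - 1]] j, ?_⟩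
    fin_cases j <;>
      simp only [Fin.sum_univ_three, rightWord, Fin.zero_eta, Fin.mk_one, Fin.reduceFinMk,
        Matrix.cons_val, mul_one, mul_assoc, H.rules, mul_add,
        mul_smul_comm] <;> module
  · refine ⟨![![0, 1, 0], ![t, t - 1, 0], ![0, 0, t]] j, ?_⟩
    fin_cases j <;>
      simp only [Fin.sum_univ_three, rightWord, Fin.zero_eta, Fin.mk_one, Fin.reduceFinMk,
        Matrix.cons_val, mul_one, mul_assoc, H.rules, mul_add,
        mul_smul_comm] <;> module
  · refine ⟨![gram t a x j 0, 0, 0], ?_⟩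
    have := H.e_rightWord_leftWord_e j 0
    simp only [leftWord, Matrix.cons_val, one_mul] at this
    simp only [Fin.sum_univ_three, this]
    simp [rightWord]

theorem e_rightWord_sum (H : IsThreeStrand t a x g₁ g₂ e) (i : Fin 3) (c : Fin 3 → F) :
    e * rightWord g₁ g₂ i * ∑ j, c j • (leftWord g₁ g₂ j * e) =
      (gram t a x).mulVec c i • e := by
  simp only [Finset.mul_sum, mul_smul_comm, H.e_rightWord_leftWord_e, smul_smul, Matrix.mulVec,
    dotProduct, Finset.sum_smul, mul_comm]

/-- If `G c = 0`, then the element `z = ∑ cⱼ hⱼ e` satisfies `z A z = 0`. -/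
theorem mul_mul_eq_zero (H : IsThreeStrand t a x g₁ g₂ e) {c : Fin 3 → F}
    (hc : (gram t a x).mulVec c = 0) (y : A) :
    (∑ j, c j • (leftWord g₁ g₂ j * e)) * y * (∑ j, c j • (leftWord g₁ g₂ j * e)) = 0 := by
  obtain ⟨d, hd⟩ := H.e_mul_mem y
  have h0 : e * y * (∑ j, c j • (leftWord g₁ g₂ j * e)) = 0 := by
    rw [hd, Finset.sum_mul]
    refine Finset.sum_eq_zero fun i _ ↦ ?_
    rw [smul_mul_assoc, H.e_rightWord_sum, hc, Pi.zero_apply, zero_smul, smul_zero]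
  have h1 : (∑ j, c j • (leftWord g₁ g₂ j * e)) = (∑ j, c j • leftWord g₁ g₂ j) * e := by
    simp only [Finset.sum_mul, smul_mul_assoc]
  nth_rewrite 1 [h1]
  rw [mul_assoc _ e y, mul_assoc, h0, mul_zero]

/-- If `∑ c_j h_j e ≠ 0` then `G c ≠ 0`, and any nonzero entry of `G c` says which `e h'_i` brings
the element back to a nonzero multiple of `e`. -/
theorem generatesMinimal_e (H : IsThreeStrand t a x g₁ g₂ e) (hG : (gram t a x).det ≠ 0) :
    GeneratesMinimal e := by
  intro y hy
  obtain ⟨c, hc⟩ := H.mul_e_mem y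
  have hc0 : (gram t a x).mulVec c ≠ 0 := by
    intro h0
    have : c = 0 := Matrix.eq_zero_of_mulVec_eq_zero hG h0
    exact hy (by simp [hc, this])
  obtain ⟨i, hi⟩ := Function.ne_iff.mp hc0
  refine ⟨((gram t a x).mulVec c i)⁻¹ • (e * rightWord g₁ g₂ i), ?_⟩
  rw [hc, smul_mul_assoc, H.e_rightWord_sum, smul_smul, inv_mul_cancel₀ hi, one_smul]

/-- The ideal generated by `e` contains an element acting as a right identity on `e A`. -/
theorem exists_right_identity (H : IsThreeStrand t a x g₁ g₂ e) (hG : (gram t a x).det ≠ 0) :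
    ∃ u ∈ socle A, ∀ y, e * y * u = e * y := by
  -- Multiplying by `e h'_k` on the left turns the coefficients `G⁻¹` into `G G⁻¹ = 1`.
  refine ⟨∑ i, ∑ j, (gram t a x)⁻¹ i j • (leftWord g₁ g₂ i * e * rightWord g₁ g₂ j),
    sum_mem fun i _ ↦ sum_mem fun j _ ↦ smul_mem_socle _ (mul_mem_socle_right
      (mul_mem_socle_left _ (mem_socle (H.generatesMinimal_e hG))) _), fun y ↦ ?_⟩
  have key (k : Fin 3) : e * rightWord g₁ g₂ k *
      (∑ i, ∑ j, (gram t a x)⁻¹ i j • (leftWord g₁ g₂ i * e * rightWord g₁ g₂ j)) =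
      e * rightWord g₁ g₂ k := by
    have hinv : gram t a x * (gram t a x)⁻¹ = 1 :=
      Matrix.mul_nonsing_inv _ (isUnit_iff_ne_zero.mpr hG)
    rw [Finset.sum_comm]
    simp only [Finset.mul_sum, mul_smul_comm]
    calc _ = ∑ j, (gram t a x * (gram t a x)⁻¹) k j • (e * rightWord g₁ g₂ j) := by
          refine Finset.sum_congr rfl fun j _ ↦ ?_
          rw [Matrix.mul_apply, Finset.sum_smul]
          refine Finset.sum_congr rfl fun i _ ↦ ?_
          rw [← mul_assoc, H.e_rightWord_leftWord_e, smul_mul_assoc, smul_smul, mul_comm]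
      _ = _ := by simp [hinv, Matrix.one_apply]
  obtain ⟨d, hd⟩ := H.e_mul_mem y
  rw [hd, Finset.sum_mul]
  exact Finset.sum_congr rfl fun j _ ↦ by rw [smul_mul_assoc, key]

/-- With `v = 1 - u`, each `y` agrees with `y v` modulo the socle, and `e` kills `A v` from the
left. Only the Hecke generators remain to be checked on `y v`. -/
theorem exists_complement (H : IsThreeStrand t a x g₁ g₂ e) (hG : (gram t a x).det ≠ 0) :
    ∃ v : A, (∀ y, e * (y * v) = 0) ∧ ∀ y, y * v ∈ socle A → y ∈ socle A := by
  obtain ⟨u, hu, h⟩ := H.exists_right_identity hG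
  refine ⟨1 - u, fun y ↦ by rw [← mul_assoc, mul_sub, mul_one, h, sub_self], fun y hy ↦ ?_⟩
  have := add_mem hy (mul_mem_socle_left y hu)
  rwa [← mul_add, sub_add_cancel, mul_one] at this

/-! ### The Hecke algebra constituents inside the socle. -/

/-- The symmetrizer of the Hecke algebra. -/
theorem symmetrizer_mem_socle (H : IsThreeStrand t a x g₁ g₂ e) (hG : (gram t a x).det ≠ 0) :
    1 + g₁ + g₂ + g₁ * g₂ + g₂ * g₁ + g₁ * g₂ * g₁ ∈ socle A := by
  obtain ⟨v, hv, hvs⟩ := H.exists_complement hG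
  refine hvs _ (mem_socle (.of_eigenvector H.adjoin_eq_top ?_))
  simp only [Set.mem_insert_iff, Set.mem_singleton_iff]
  rintro s (rfl | rfl | rfl)
  · refine ⟨t, ?_⟩
    rw [← mul_assoc, ← smul_mul_assoc]
    congr 1
    simp only [mul_add, mul_one, mul_assoc, H.rules]
    module
  · refine ⟨t, ?_⟩
    rw [← mul_assoc, ← smul_mul_assoc]
    congr 1
    simp only [mul_add, mul_one, mul_assoc, H.rules, mul_smul_comm]
    module
  · exact ⟨0, by rw [hv, zero_smul]⟩

/-- The antisymmetrizer of the Hecke algebra. -/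
theorem antisymmetrizer_mem_socle (H : IsThreeStrand t a x g₁ g₂ e) :
    t ^ 3 • 1 - t ^ 2 • g₁ - t ^ 2 • g₂ + t • (g₁ * g₂) + t • (g₂ * g₁) - g₁ * g₂ * g₁
      ∈ socle A := by
  refine mem_socle (.of_eigenvector H.adjoin_eq_top ?_)
  simp only [Set.mem_insert_iff, Set.mem_singleton_iff]
  rintro s (rfl | rfl | rfl)
  · refine ⟨-1, ?_⟩
    simp only [mul_add, mul_sub, mul_one, mul_assoc, H.rules, mul_smul_comm]
    module
  · refine ⟨-1, ?_⟩
    simp only [mul_add, mul_sub, mul_one, mul_assoc, H.rules, mul_smul_comm]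
    module
  -- Since `e g₁ = t e`, the six terms cancel in pairs, so no factor `v` is required.
  · refine ⟨0, ?_⟩
    simp only [mul_add, mul_sub, mul_one, mul_assoc, H.rules, mul_smul_comm]
    module

/-- Subtracting `κ p` removes the symmetrizer component from `g₁ + 1`. What is left, times `v`,
generates a module spanned by `w` and `g₂ w`, and every nonzero vector there can be moved back to
`w`. -/
theorem g₁_add_one_mem_socle (H : IsThreeStrand t a x g₁ g₂ e) (hG : (gram t a x).det ≠ 0)
    (ht0 : t ≠ 0) (ht : 1 + t + t ^ 2 ≠ 0) : g₁ + 1 ∈ socle A := by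
  obtain ⟨v, hv, hvs⟩ := H.exists_complement hG
  set p := 1 + g₁ + g₂ + g₁ * g₂ + g₂ * g₁ + g₁ * g₂ * g₁ with hp
  obtain ⟨κ, hκ⟩ : ∃ κ, (1 + t + t ^ 2) * κ = 1 := ⟨_, mul_inv_cancel₀ ht⟩
  suffices h : g₁ + 1 - κ • p ∈ socle A by
    have := add_mem h (smul_mem_socle κ (H.symmetrizer_mem_socle hG))
    rwa [sub_add_cancel] at this
  refine hvs _ (mem_socle ?_)
  set w := (g₁ + 1 - κ • p) * v with hw
  have h1 : g₁ * w = t • w := by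
    rw [hw, ← mul_assoc, ← smul_mul_assoc, hp]
    congr 1
    simp only [mul_add, mul_sub, mul_one, mul_assoc, H.rules, mul_smul_comm]
    module
  -- Put `s = 1 + g₂ + g₁g₂`. Then `s (g₁ + 1) = p` and `s p = (1 + t + t²) p`, so the choice of `κ`
  -- gives `s w = 0`.
  have h12 : g₁ * (g₂ * w) = -w - g₂ * w := by
    have : g₁ * (g₂ * (g₁ + 1 - κ • p)) = -(g₁ + 1 - κ • p) - g₂ * (g₁ + 1 - κ • p) := by
      rw [hp]
      simp only [mul_add, mul_sub, mul_one, mul_assoc, H.rules, mul_smul_comm]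
      linear_combination (norm := module) (-hκ) • (1 + g₁ + g₂ + g₁ * g₂ + g₂ * g₁ + g₁ * (g₂ * g₁))
    rw [hw, ← mul_assoc g₂, ← mul_assoc g₁, this, sub_mul, neg_mul]
  have he : e * w = 0 := hv _
  have he2 : e * (g₂ * w) = 0 := by rw [hw, ← mul_assoc g₂]; exact hv _
  have hspan (y : A) : ∃ α β : F, y * w = α • w + β • (g₂ * w) := by
    suffices h : y * w ∈ Submodule.span F {w, g₂ * w} by
      obtain ⟨α, β, h⟩ := Submodule.mem_span_pair.mp h
      exact ⟨α, β, h.symm⟩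
    refine mul_mem_of_adjoin_eq_top H.adjoin_eq_top ?_ y (Submodule.subset_span (by simp))
    simp only [Set.mem_insert_iff, Set.mem_singleton_iff]
    rintro s (rfl | rfl | rfl) _ (rfl | rfl) <;> rw [Submodule.mem_span_pair]
    · exact ⟨t, 0, by rw [h1]; module⟩
    · exact ⟨-1, -1, by rw [h12]; module⟩
    · exact ⟨0, 1, by module⟩
    · exact ⟨t, t - 1, by rw [H.rules.2.2.2.1]; module⟩
    · exact ⟨0, 0, by rw [he]; module⟩
    · exact ⟨0, 0, by rw [he2]; module⟩
  have hg (α β : F) : (g₁ + 1) * (α • w + β • (g₂ * w)) = ((1 + t) * α - β) • w := by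
    simp only [add_mul, mul_add, one_mul, mul_smul_comm, h1, h12]
    module
  intro y hy
  obtain ⟨α, β, hαβ⟩ := hspan y
  -- If `g₁ + 1` kills the vector, applying `g₂` beforehand gives the coefficient `α t (1 + t + t²)
  -- ≠ 0`.
  by_cases hz : (1 + t) * α - β = 0
  · have hα : α ≠ 0 := by
      rintro rfl
      have : β = 0 := by simpa using hz
      exact hy (by simp [hαβ, this])
    have h2 : g₂ * (α • w + β • (g₂ * w)) =
        (β * t) • w + (α + β * (t - 1)) • (g₂ * w) := by
      simp only [mul_add, mul_smul_comm, H.rules]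
      module
    refine ⟨(α * t * (1 + t + t ^ 2))⁻¹ • ((g₁ + 1) * g₂), ?_⟩
    rw [hαβ, smul_mul_assoc, mul_assoc (g₁ + 1), h2, hg,
      show (1 + t) * (β * t) - (α + β * (t - 1)) = α * t * (1 + t + t ^ 2) by
        linear_combination (-t ^ 2 - 1) * hz,
      smul_smul, inv_mul_cancel₀ (mul_ne_zero (mul_ne_zero hα ht0) ht), one_smul]
  · refine ⟨((1 + t) * α - β)⁻¹ • (g₁ + 1), ?_⟩
    rw [hαβ, smul_mul_assoc, hg, smul_smul, inv_mul_cancel₀ hz, one_smul]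

theorem isSemisimpleRing (H : IsThreeStrand t a x g₁ g₂ e) (hG : (gram t a x).det ≠ 0)
    (ht0 : t ≠ 0) (ht1 : 1 + t ≠ 0) (ht : 1 + t + t ^ 2 ≠ 0) : IsSemisimpleRing A := by
  refine GeneratesMinimal.isSemisimpleRing ?_
  have h1 := H.g₁_add_one_mem_socle hG ht0 ht
  have h2 : g₂ + 1 ∈ socle A := by
    have h := sub_mem (mul_mem_socle_left (g₂ + 1) (mul_mem_socle_right h1 (g₂ + 1)))
      (H.symmetrizer_mem_socle hG)
    have : (g₂ + 1) * ((g₁ + 1) * (g₂ + 1)) -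
        (1 + g₁ + g₂ + g₁ * g₂ + g₂ * g₁ + g₁ * g₂ * g₁) = t • (g₂ + 1) := by
      simp only [mul_add, add_mul, mul_one, one_mul, mul_assoc, H.rules]
      module
    rw [this] at h
    simpa [smul_smul, inv_mul_cancel₀ ht0] using smul_mem_socle t⁻¹ h
  have h3 := H.antisymmetrizer_mem_socle
  -- modulo the socle `g₁ = g₂ = -1`, so the antisymmetrizer is a nonzero scalar there
  have h4 := add_mem (add_mem h3
    (mul_mem_socle_left ((t ^ 2 + t + 1) • 1 - t • g₂ + g₁ * g₂) h1))
    (mul_mem_socle_left ((t ^ 2 + t) • 1 - (t + 1) • g₁) h2)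
  have h5 := smul_mem_socle ((1 + t) * (1 + t + t ^ 2))⁻¹ h4
  convert h5 using 1
  rw [eq_inv_smul_iff₀ (mul_ne_zero ht1 ht)]
  simp only [mul_add, add_mul, sub_mul, mul_one, one_mul, mul_assoc, smul_mul_assoc]
  module

end IsThreeStrand

/-! ### The `q`-Brauer algebras on two and three strands -/

namespace QBrauer

section General

variable {F : Type*} [Field F] {n : ℕ} (r q : F)

/-- The image of a generator in the `q`-Brauer algebra. -/
def mkGen (x : Gen n) : QBrauerAlgebra F n r q :=
  RingQuot.mkAlgHom F (Rel n r q) (FreeAlgebra.ι F x)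

theorem adjoin_range_mkGen : Algebra.adjoin F (Set.range (mkGen (n := n) r q)) = ⊤ := by
  have h := congrArg (Subalgebra.map (RingQuot.mkAlgHom F (Rel n r q)))
    (FreeAlgebra.adjoin_range_ι (R := F) (X := Gen n))
  rwa [AlgHom.map_adjoin, ← Set.range_comp, Algebra.map_top,
    (AlgHom.range_eq_top _).mpr (RingQuot.mkAlgHom_surjective F _)] at h

theorem mkGen_g_mul_self (i : ℕ) (hi : 1 ≤ i ∧ i < n) :
    mkGen r q (Gen.g i hi) * mkGen r q (Gen.g i hi) =
      (q ^ 2 - 1) • mkGen r q (Gen.g i hi) + q ^ 2 • 1 := by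
  have h := RingQuot.mkAlgHom_rel F (Rel.quadratic (r := r) (q := q) i hi)
  rwa [map_pow, map_add, map_smul, AlgHom.commutes, pow_two, Algebra.algebraMap_eq_smul_one] at h

theorem mkGen_e_mul_self : mkGen r q (Gen.e (n := n)) * mkGen r q Gen.e =
    ((r - r⁻¹) / (q - q⁻¹)) • mkGen r q Gen.e := by
  have h := RingQuot.mkAlgHom_rel F (Rel.e_sq (n := n) (r := r) (q := q))
  rwa [map_pow, map_smul, pow_two] at h

theorem mkGen_e_mul_g₁ (h : 1 ≤ 1 ∧ 1 < n) :
    mkGen r q Gen.e * mkGen r q (Gen.g 1 h) = q ^ 2 • mkGen r q Gen.e := by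
  have h := RingQuot.mkAlgHom_rel F (Rel.e_g₁ (r := r) (q := q) h)
  rwa [map_mul, map_smul] at h

theorem mkGen_g₁_mul_e (h : 1 ≤ 1 ∧ 1 < n) :
    mkGen r q (Gen.g 1 h) * mkGen r q Gen.e = q ^ 2 • mkGen r q Gen.e := by
  have h := RingQuot.mkAlgHom_rel F (Rel.g₁_e (r := r) (q := q) h)
  rwa [map_mul, map_smul] at h

end General

/-! ### Two strands. -/

section Two

variable {F : Type*} [Field F] (r q : F)

theorem exists_algHom_two {B : Type*} [Ring B] [Algebra F B] (G E : B)
    (hG : G * G = (q ^ 2 - 1) • G + q ^ 2 • 1) (hE : E * E = ((r - r⁻¹) / (q - q⁻¹)) • E)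
    (hEG : E * G = q ^ 2 • E) (hGE : G * E = q ^ 2 • E) :
    ∃ φ : QBrauerAlgebra F 2 r q →ₐ[F] B,
      φ (mkGen r q (Gen.g 1 (by norm_num))) = G ∧ φ (mkGen r q Gen.e) = E := by
  let f : Gen 2 → B := fun x ↦ match x with
    | .g _ _ => G
    | .e => E
  refine ⟨RingQuot.liftAlgHom F ⟨FreeAlgebra.lift F f, fun {u v} huv ↦ ?_⟩, ?_, ?_⟩
  · cases huv with
    | quadratic i hi => simpa [g, f, pow_two, Algebra.algebraMap_eq_smul_one] using hG
    | braid i hi hi' => omega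
    | comm i j hi hj hij => omega
    | e_sq => simpa [e, f, pow_two] using hE
    | e_comm i hi h2 => omega
    | e_g₁ h => simpa [e, g, f] using hEG
    | g₁_e h => simpa [e, g, f] using hGE
    | e_g₂_e h => omega
    | e_g₂Inv_e h => omega
    | c_e₂ hn => omega
  · simp [mkGen, f]
  · simp [mkGen, f]

/-- Common eigenvectors for the characters `(g₁, e) ↦ (q², a)`, `(-1, 0)` and `(q², 0)` combine to
`(1 + q²) • 1`; the third one requires dividing by `a`. -/
theorem isSemisimpleRing_two (ha : (r - r⁻¹) / (q - q⁻¹) ≠ 0) (ht : 1 + q ^ 2 ≠ 0) :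
    IsSemisimpleRing (QBrauerAlgebra F 2 r q) := by
  open GeneratesMinimal in
  set g₁ := mkGen r q (Gen.g 1 (by norm_num : 1 ≤ 1 ∧ 1 < 2))
  set E := mkGen r q (Gen.e (n := 2))
  set a := (r - r⁻¹) / (q - q⁻¹)
  have gg : g₁ * g₁ = (q ^ 2 - 1) • g₁ + q ^ 2 • 1 := mkGen_g_mul_self r q 1 _
  have ee : E * E = a • E := mkGen_e_mul_self r q
  have eg : E * g₁ = q ^ 2 • E := mkGen_e_mul_g₁ r q _
  have ge : g₁ * E = q ^ 2 • E := mkGen_g₁_mul_e r q _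
  have key {x : QBrauerAlgebra F 2 r q} (c d : F) (hc : g₁ * x = c • x) (hd : E * x = d • x) :
      GeneratesMinimal x := by
    refine .of_eigenvector (adjoin_range_mkGen r q) ?_
    rintro _ ⟨y, rfl⟩
    cases y with
    | g i hi =>
      obtain rfl : i = 1 := by omega
      exact ⟨c, hc⟩
    | e => exact ⟨d, hd⟩
  have h1 : E ∈ socle _ := mem_socle (key (q ^ 2) a ge ee)
  have h2 : g₁ - q ^ 2 • 1 ∈ socle _ := mem_socle (key (-1) 0
    (by simp only [mul_sub, mul_smul_comm, mul_one, gg]; module)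
    (by simp only [mul_sub, mul_smul_comm, mul_one, eg]; module))
  have h3 : (g₁ + 1) - ((1 + q ^ 2) * a⁻¹) • E ∈ socle _ := mem_socle (key (q ^ 2) 0
    (by simp only [mul_add, mul_sub, mul_smul_comm, mul_one, gg, ge]; module)
    (by
      simp only [mul_add, mul_sub, mul_smul_comm, mul_one, eg, ee, smul_smul,
        inv_mul_cancel_right₀ ha]
      module))
  refine GeneratesMinimal.isSemisimpleRing ?_
  have h4 := smul_mem_socle (1 + q ^ 2)⁻¹
    (add_mem (sub_mem h3 h2) (smul_mem_socle ((1 + q ^ 2) * a⁻¹) h1))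
  convert h4 using 1
  rw [eq_inv_smul_iff₀ ht]
  module

theorem one_add_sq_ne_zero_of_isSemisimpleRing_two (h : IsSemisimpleRing (QBrauerAlgebra F 2 r q)) :
    1 + q ^ 2 ≠ 0 := by
  intro ht
  -- When `q² = -1` the quadratic relation reads `(g₁ + 1)² = 0`, so `g₁ + 1` can map to `ε`.
  obtain ⟨φ, h1, -⟩ := exists_algHom_two r q (DualNumber.eps - 1 : DualNumber F) 0
    (by
      rw [eq_neg_of_add_eq_zero_right ht]
      have := DualNumber.eps_mul_eps (R := F)
      simp only [mul_sub, sub_mul, this, mul_one, one_mul]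
      module)
    (by simp) (by simp) (by simp)
  refine not_isSemisimpleRing_of_map φ.toRingHom
    (mkGen r q (Gen.g 1 (by norm_num : 1 ≤ 1 ∧ 1 < 2)) + 1) ?_ ?_ h
  · intro h0
    have h0' : (DualNumber.eps : DualNumber F) = 0 := by simpa [h1] using h0
    simpa using congrArg TrivSqZeroExt.snd h0'
  · intro y
    simp [h1, mul_right_comm _ _ (DualNumber.eps : DualNumber F)]

end Two

/-! ### Three strands: presentation and obstructing representations. -/

section Three

variable {F : Type*} [Field F] (r q : F)

theorem sq_sub_one_ne_zero {q : F} (hq : q ≠ 0) (hq' : q - q⁻¹ ≠ 0) : q ^ 2 - 1 ≠ 0 := by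
  intro h
  have : q * (q - q⁻¹) = q ^ 2 - 1 := by field_simp
  exact mul_ne_zero hq hq' (this.trans h)

theorem isThreeStrand : IsThreeStrand (q ^ 2) ((r - r⁻¹) / (q - q⁻¹)) (r * q)
    (mkGen r q (Gen.g 1 (by norm_num : 1 ≤ 1 ∧ 1 < 3)))
    (mkGen r q (Gen.g 2 (by norm_num : 1 ≤ 2 ∧ 2 < 3))) (mkGen r q (Gen.e (n := 3))) where
  adjoin_eq_top := by
    rw [← adjoin_range_mkGen r q]
    congr 1
    ext y
    simp only [Set.mem_insert_iff, Set.mem_singleton_iff, Set.mem_range]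
    constructor
    · rintro (rfl | rfl | rfl) <;> exact ⟨_, rfl⟩
    · rintro ⟨z, rfl⟩
      cases z with
      | g i hi =>
        obtain rfl | rfl : i = 1 ∨ i = 2 := by omega
        · exact .inl rfl
        · exact .inr (.inl rfl)
      | e => exact .inr (.inr rfl)
  g₁_sq := mkGen_g_mul_self r q 1 _
  g₂_sq := mkGen_g_mul_self r q 2 _
  braid := by
    have h := RingQuot.mkAlgHom_rel F (Rel.braid (n := 3) (r := r) (q := q) 1 (by norm_num)
      (by norm_num))
    rwa [map_mul, map_mul, map_mul, map_mul] at h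
  e_sq := mkGen_e_mul_self r q
  e_g₁ := mkGen_e_mul_g₁ r q _
  g₁_e := mkGen_g₁_mul_e r q _
  e_g₂_e := by
    have h := RingQuot.mkAlgHom_rel F (Rel.e_g₂_e (n := 3) (r := r) (q := q) (by norm_num))
    rwa [map_mul, map_mul, map_smul] at h

variable {r q}

theorem exists_algHom_three (hr : r ≠ 0) (hq : q ≠ 0) (hq' : q - q⁻¹ ≠ 0)
    {B : Type*} [Ring B] [Algebra F B] (G₁ G₂ E : B)
    (hG₁ : G₁ * G₁ = (q ^ 2 - 1) • G₁ + q ^ 2 • 1) (hG₂ : G₂ * G₂ = (q ^ 2 - 1) • G₂ + q ^ 2 • 1)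
    (hb : G₁ * G₂ * G₁ = G₂ * G₁ * G₂)
    (hE : E * E = ((r - r⁻¹) / (q - q⁻¹)) • E)
    (hEG : E * G₁ = q ^ 2 • E) (hGE : G₁ * E = q ^ 2 • E) (hEGE : E * G₂ * E = (r * q) • E) :
    ∃ φ : QBrauerAlgebra F 3 r q →ₐ[F] B,
      φ (mkGen r q (Gen.g 1 (by norm_num))) = G₁ ∧ φ (mkGen r q (Gen.g 2 (by norm_num))) = G₂ ∧
        φ (mkGen r q Gen.e) = E := by
  let f : Gen 3 → B := fun x ↦ match x with
    | .g i _ => if i = 1 then G₁ else G₂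
    | .e => E
  refine ⟨RingQuot.liftAlgHom F ⟨FreeAlgebra.lift F f, fun {u v} huv ↦ ?_⟩, ?_, ?_, ?_⟩
  · cases huv with
    | quadratic i hi =>
      obtain rfl | rfl : i = 1 ∨ i = 2 := by omega
      · simpa [g, f, pow_two, Algebra.algebraMap_eq_smul_one] using hG₁
      · simpa [g, f, pow_two, Algebra.algebraMap_eq_smul_one] using hG₂
    | braid i hi hi' =>
      obtain rfl : i = 1 := by omega
      simpa [g, f] using hb
    | comm i j hi hj hij => omega
    | e_sq => simpa [e, f, pow_two] using hE
    | e_comm i hi h2 => omega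
    | e_g₁ h => simpa [e, g, f] using hEG
    | g₁_e h => simpa [e, g, f] using hGE
    | e_g₂_e h => simpa [e, g, f] using hEGE
    | e_g₂Inv_e h =>
      -- The relation for `e g₂⁻¹ e` follows from those for `e²` and `e g₂ e`, by the value of `a`.
      have hs : (q ^ 2)⁻¹ * (r * q - (q ^ 2 - 1) * ((r - r⁻¹) / (q - q⁻¹))) = (r * q)⁻¹ := by
        have : q ^ 2 - 1 ≠ 0 := sq_sub_one_ne_zero hq hq'
        field_simp
        ring
      have : E * ((q ^ 2)⁻¹ • (G₂ - (q ^ 2 - 1) • 1)) * E = (r * q)⁻¹ • E := by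
        simp only [mul_smul_comm, smul_mul_assoc, mul_sub, sub_mul, mul_one, hEGE, hE]
        rw [← hs]
        module
      simpa [e, g, gInv, f, Algebra.algebraMap_eq_smul_one, sub_smul] using this
    | c_e₂ hn => omega
  · simp [mkGen, f]
  · simp [mkGen, f]
  · simp [mkGen, f]

theorem one_add_sq_ne_zero_of_isSemisimpleRing_three (hr : r ≠ 0) (hq : q ≠ 0)
    (hq' : q - q⁻¹ ≠ 0) (h : IsSemisimpleRing (QBrauerAlgebra F 3 r q)) : 1 + q ^ 2 ≠ 0 := by
  intro ht
  have hG : (DualNumber.eps - 1 : DualNumber F) * (DualNumber.eps - 1) =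
      (q ^ 2 - 1) • (DualNumber.eps - 1) + q ^ 2 • 1 := by
    rw [eq_neg_of_add_eq_zero_right ht]
    have := DualNumber.eps_mul_eps (R := F)
    simp only [mul_sub, sub_mul, this, mul_one, one_mul]
    module
  obtain ⟨φ, h1, -⟩ := exists_algHom_three hr hq hq' _ _ 0 hG hG rfl
    (by simp) (by simp) (by simp) (by simp)
  refine not_isSemisimpleRing_of_map φ.toRingHom
    (mkGen r q (Gen.g 1 (by norm_num : 1 ≤ 1 ∧ 1 < 3)) + 1) ?_ ?_ h
  · intro h0
    have h0' : (DualNumber.eps : DualNumber F) = 0 := by simpa [h1] using h0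
    simpa using congrArg TrivSqZeroExt.snd h0'
  · intro y
    simp [h1, mul_right_comm _ _ (DualNumber.eps : DualNumber F)]

theorem one_add_sq_add_ne_zero_of_isSemisimpleRing_three (hr : r ≠ 0) (hq : q ≠ 0)
    (hq' : q - q⁻¹ ≠ 0) (h : IsSemisimpleRing (QBrauerAlgebra F 3 r q)) :
    1 + q ^ 2 + (q ^ 2) ^ 2 ≠ 0 := by
  intro ht
  -- A triangular representation with diagonal characters `q²` and `-1`. The braid relation holds
  -- exactly when `1 + q² + q⁴ = 0`, and `g₁ - g₂` becomes strictly upper triangular.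
  obtain ⟨φ, h1, h2, h3⟩ := exists_algHom_three hr hq hq'
    (!![q ^ 2, 0; 0, -1] : Matrix (Fin 2) (Fin 2) F) !![q ^ 2, 1; 0, -1] 0
    (by ext i j; fin_cases i <;> fin_cases j <;> simp <;> ring)
    (by ext i j; fin_cases i <;> fin_cases j <;> simp <;> ring)
    (by
      ext i j
      fin_cases i <;> fin_cases j <;> simp <;> linear_combination -ht)
    (by simp) (by simp) (by simp) (by simp)
  have htri (y) : φ y 1 0 = 0 := by
    have hy : y ∈ (⊤ : Subalgebra F (QBrauerAlgebra F 3 r q)) := trivial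
    rw [← (isThreeStrand r q).adjoin_eq_top] at hy
    induction hy using Algebra.adjoin_induction with
    | mem s hs =>
      simp only [Set.mem_insert_iff, Set.mem_singleton_iff] at hs
      obtain rfl | rfl | rfl := hs <;> simp [h1, h2, h3]
    | algebraMap c => simp [Matrix.algebraMap_matrix_apply]
    | add a b _ _ ha hb => simp [ha, hb]
    | mul a b _ _ ha hb => simp [Matrix.mul_apply, ha, hb]
  refine not_isSemisimpleRing_of_map φ.toRingHom
    (mkGen r q (Gen.g 1 (by norm_num : 1 ≤ 1 ∧ 1 < 3)) -
      mkGen r q (Gen.g 2 (by norm_num : 1 ≤ 2 ∧ 2 < 3))) ?_ ?_ h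
  · intro h0
    simpa [h1, h2] using congrFun (congrFun h0 0) 1
  · intro y
    have := htri y
    ext i j
    fin_cases i <;> fin_cases j <;> simp [h1, h2, Matrix.mul_apply, Matrix.vecMul, dotProduct, this]

theorem det_gram_ne_zero_of_isSemisimpleRing_three (hr : r ≠ 0) (hq : q ≠ 0)
    (hq' : q - q⁻¹ ≠ 0) (ha : (r - r⁻¹) / (q - q⁻¹) ≠ 0)
    (h : IsSemisimpleRing (QBrauerAlgebra F 3 r q)) :
    (IsThreeStrand.gram (q ^ 2) ((r - r⁻¹) / (q - q⁻¹)) (r * q)).det ≠ 0 := by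
  intro hdet
  obtain ⟨c, hc0, hc⟩ := Matrix.exists_mulVec_eq_zero_iff.mpr hdet
  set a := (r - r⁻¹) / (q - q⁻¹) with ha_def
  -- The matrices record the action on the family `h_j e`; the nonzero row for `e` is row `0` of
  -- `G`. Column `0` of the image of `∑ c_j h_j e` is `a c`, which is nonzero as `a ≠ 0`.
  obtain ⟨φ, h1, h2, h3⟩ := exists_algHom_three hr hq hq'
    (!![q ^ 2, 0, 0; 0, 0, q ^ 2; 0, 1, q ^ 2 - 1] : Matrix (Fin 3) (Fin 3) F)
    !![0, q ^ 2, 0; 1, q ^ 2 - 1, 0; 0, 0, q ^ 2]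
    !![a, r * q, q ^ 2 * (r * q); 0, 0, 0; 0, 0, 0]
    (by ext i j; fin_cases i <;> fin_cases j <;> simp [Fin.sum_univ_three, Matrix.mul_apply] <;> ring)
    (by ext i j; fin_cases i <;> fin_cases j <;> simp [Fin.sum_univ_three, Matrix.mul_apply] <;> ring)
    (by ext i j; fin_cases i <;> fin_cases j <;> simp [Fin.sum_univ_three, Matrix.mul_apply] <;> ring)
    (by
      rw [← ha_def]
      ext i j
      fin_cases i <;> fin_cases j <;> simp [Fin.sum_univ_three, Matrix.mul_apply])
    (by ext i j; fin_cases i <;> fin_cases j <;> simp [Fin.sum_univ_three, Matrix.mul_apply] <;> ring)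
    (by ext i j; fin_cases i <;> fin_cases j <;> simp [Fin.sum_univ_three, Matrix.mul_apply])
    (by ext i j; fin_cases i <;> fin_cases j <;> simp [Fin.sum_univ_three, Matrix.mul_apply])
  have H := isThreeStrand r q
  refine not_isSemisimpleRing_of_map φ.toRingHom _ ?_
    (fun y ↦ by rw [H.mul_mul_eq_zero hc y, map_zero]) h
  intro h0
  refine hc0 (funext fun i ↦ ?_)
  have hi : φ _ i 0 = 0 := congrFun (congrFun h0 i) 0
  have : c i * a = 0 := by
    rw [← hi]
    fin_cases i <;>
      simp [Fin.sum_univ_three, IsThreeStrand.leftWord, h1, h2, h3]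
  simpa [ha] using this

theorem det_gram (hr : r ≠ 0) (hq : q ≠ 0) (hq' : q - q⁻¹ ≠ 0) :
    (IsThreeStrand.gram (q ^ 2) ((r - r⁻¹) / (q - q⁻¹)) (r * q)).det =
      q ^ 5 * (r ^ 2 - q ^ 2) ^ 2 * (q ^ 4 * r ^ 2 - 1) / (r ^ 3 * (q ^ 2 - 1) ^ 3) := by
  have h : q ^ 2 - 1 ≠ 0 := sq_sub_one_ne_zero hq hq'
  have ha : (r - r⁻¹) / (q - q⁻¹) = q * (r ^ 2 - 1) / (r * (q ^ 2 - 1)) := by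
    field_simp
  rw [ha, IsThreeStrand.gram, Matrix.det_fin_three]
  simp only [Matrix.of_apply, Matrix.cons_val]
  field_simp
  ring

end Three

end QBrauer

open QBrauer in
theorem proposition5p1 {F : Type*} [Field F] (r q : F) (hr : r ≠ 0) (hq : q ≠ 0)
    (hq' : q - q⁻¹ ≠ 0) (ha : (r - r⁻¹) / (q - q⁻¹) ≠ 0) :
    (IsSemisimpleRing (QBrauerAlgebra F 2 r q) ↔ 2 < quantumChar (q ^ 2)) ∧
    (IsSemisimpleRing (QBrauerAlgebra F 3 r q) ↔
      3 < quantumChar (q ^ 2) ∧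
        q ^ 5 * (r ^ 2 - q ^ 2) ^ 2 * (q ^ 4 * r ^ 2 - 1) / (r ^ 3 * (q ^ 2 - 1) ^ 3) ≠ 0) := by
  rw [two_lt_quantumChar_iff, three_lt_quantumChar_iff, ← det_gram hr hq hq']
  refine ⟨⟨one_add_sq_ne_zero_of_isSemisimpleRing_two r q, isSemisimpleRing_two r q ha⟩,
    fun h ↦ ⟨⟨one_add_sq_ne_zero_of_isSemisimpleRing_three hr hq hq' h,
      one_add_sq_add_ne_zero_of_isSemisimpleRing_three hr hq hq' h⟩,
      det_gram_ne_zero_of_isSemisimpleRing_three hr hq hq' ha h⟩,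
    fun ⟨⟨h1, h2⟩, h3⟩ ↦ (isThreeStrand r q).isSemisimpleRing h3 (pow_ne_zero 2 hq) h1 h2⟩
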